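/- Let $d\in\mathbb N$ and let $u:\mathbb Z^d\to\mathbb R$ satisfy $|u(k)|\le C\mathrm e^{-\alpha\|k\|_1}$ for all $k\in\mathbb Z^d$, with constants $C,\alpha>0$. Let $F(z)=\sum_{k\in\mathbb Z^d}u(-k)z^k$ (defined for $z\in\mathbb C^d$ near $\mathbf 1=(1,\dots,1)$), and let $I_0\in\mathbb N_0^d$ be a multi-index with $(D_z^{I_0}F)(\mathbf 1)\neq 0$ and $(D_z^{I}F)(\mathbf 1)=0$ for all $I\in\mathbb N_0^d$ with $I\le I_0$ componentwise and $I\ne I_0$. Let $\mu$ be a probability measure on $\mathbb R$ with bounded support and with a density $\rho\in\mathrm{BV}(\mathbb R)$, that is, $\rho\in L^1(\mathbb R)$ and the distributional derivative of $\rho$ is a finite signed Borel measure. Let $\Omega=(\operatorname{supp}\mu)^{\mathbb Z^d}$ and $\mathbb P=\bigotimes_{k\in\mathbb Z^d}\mu$. For $\omega\in\Omega$ let $h_\omega=h_0+v_\omega$ on $\ell^2(\mathbb Z^d)$, where $(h_0\psi)(x)=\sum_{\|x-y\|_1=1}(\psi(x)-\psi(y))$ and $v_\omega$ is multiplication by $v_\omega(x)=\sum_{k\in\mathbb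 Z^d}\omega_k u(x-k)$. For a finite set $\Lambda\subset\mathbb Z^d$ let $h_\omega^{\Lambda}=\pi_\Lambda h_\omega\iota_\Lambda$ on $\ell^2(\Lambda)$, where $\iota_\Lambda$ is the extension by zero and $\pi_\Lambda$ the restriction to $\Lambda$. Write $\Lambda_l(j)=([-l,l]^d+j)\cap\mathbb Z^d$. For $x,y\in\mathbb Z^d$ and real $l_1,l_2>0$ put $\mathfrak C_1=\Lambda_{l_1}(x)$, $\mathfrak C_1^+=\Lambda_{4l_1}(x)$, $\mathfrak C_2=\Lambda_{l_2}(y)$, $\mathfrak C_2^+=\Lambda_{4l_2}(y)$, and for $\omega\in\Omega$ define the uniform distance $$\tilde d\bigl(\sigma(h_\omega^{\mathfrak C_1}),\sigma(h_\omega^{\mathfrak C_2})\bigr)=\inf_{\omega_1^\perp,\ \omega_2^\perp} d\Bigl(\sigma\bigl(h^{\mathfrak C_1}_{(\omega_1,\omega_1^\perp)}\bigr),\sigma\bigl(h^{\mathfrak C_2}_{(\omega_2,\omega_2^\perp)}\bigr)\Bigr),$$ where $d(A,B)=\inf\{|a-b|:a\in A,\ b\in B\}$, $\omega_i$ is the restriction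 of $\omega$ to $\mathfrak C_i^+$, $(\omega_i,\omega_i^\perp)$ is the configuration equal to $\omega_i$ on $\mathfrak C_i^+$ and to $\omega_i^\perp$ off $\mathfrak C_i^+$, and $\omega_i^\perp$ runs, independently for $i=1,2$, over $(\operatorname{supp}\mu)^{\mathbb Z^d\setminus\mathfrak C_i^+}$. Then there are constants $l_0$, depending only on $u$ (including $C$, $\alpha$ and the choice of $I_0$), and $C_1>0$ and $C_2$, depending only on these data and on $\rho$, such that for all $x,y\in\mathbb Z^d$ and all $l_1,l_2>0$ with $\mathfrak C_1^+\cap\mathfrak C_2^+=\emptyset$ and $l_2\ge l_0$, and for all $\epsilon>0$, $$\mathbb P\Bigl(\Bigl\{\omega\in\Omega:\tilde d\bigl(\sigma(h_\omega^{\mathfrak C_1}),\sigma(h_\omega^{\mathfrak C_2})\bigr)<\epsilon\Bigr\}\Bigr)\le C_1\bigl(2\max\{l_1,l_2\}+1\bigr)^{3d+\|I_0\|_1}\Bigl[\epsilon+C_2\,\mathrm e^{-3\min\{l_1,l_2\}\alpha/2}\Bigr].$$ -/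

import Mathlib

open MeasureTheory
open scoped ENNReal

noncomputable section

namespace AlloyType

/-- The lattice `ℤ^d`. -/
abbrev Site (d : ℕ) : Type := Fin d → ℤ

/-- The norm `‖k‖₁` on `ℤ^d`. -/
def norm1 {d : ℕ} (k : Site d) : ℤ := ∑ r, |k r|

/-- The cube `([-l, l]^d + j) ∩ ℤ^d`. -/
def cube {d : ℕ} (l : ℝ) (j : Site d) : Set (Site d) :=
  {k | ∀ r, |(k r : ℝ) - (j r : ℝ)| ≤ l}

/-! ### The single-site potential, its generating function and the multi-index `I₀` -/

/-- Exponential decay `|u k| ≤ C exp (-α ‖k‖₁)` with `C, α > 0`. -/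
def ExpDecay {d : ℕ} (u : Site d → ℝ) (C α : ℝ) : Prop :=
  0 < C ∧ 0 < α ∧ ∀ k, |u k| ≤ C * Real.exp (-α * (norm1 k : ℝ))

/-- The generating function `F z = ∑ₖ u (-k) z^k`, where `z^k = ∏ᵣ zᵣ ^ kᵣ`. For exponentially
decaying `u` the series converges absolutely in a neighbourhood of `(1, …, 1)`. -/
def genFun {d : ℕ} (u : Site d → ℝ) (z : Fin d → ℂ) : ℂ :=
  ∑' k : Site d, (u (-k) : ℂ) * ∏ r, z r ^ k r

/-- The partial derivative `∂/∂zᵣ`. -/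
def partialDeriv {d : ℕ} (r : Fin d) (G : (Fin d → ℂ) → ℂ) : (Fin d → ℂ) → ℂ :=
  fun z => deriv (fun t : ℂ => G (Function.update z r t)) (z r)

/-- The iterated partial derivative `∂₁^{I₁} ∂₂^{I₂} ⋯ ∂_d^{I_d}`. -/
def multiDeriv {d : ℕ} (I : Fin d → ℕ) (G : (Fin d → ℂ) → ℂ) : (Fin d → ℂ) → ℂ :=
  (List.finRange d).foldr (fun r H => (partialDeriv r)^[I r] H) G

/-- `(D^I F)(1, …, 1)` is nonzero for `I = I₀` and zero for all multi-indices `I < I₀`, where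
`I < I₀` means that `I ≤ I₀` componentwise and `I ≠ I₀`. -/
def IsLeadingIndex {d : ℕ} (u : Site d → ℝ) (I₀ : Fin d → ℕ) : Prop :=
  multiDeriv I₀ (genFun u) 1 ≠ 0 ∧ ∀ I : Fin d → ℕ, I < I₀ → multiDeriv I (genFun u) 1 = 0

/-! ### The distribution of the coupling constants -/

/-- `ρ ∈ BV(ℝ)`: `ρ` is integrable and its distributional derivative is a (finite) signed Borel
measure `ν`, that is `∫ φ dν = - ∫ ρ φ'` for all test functions `φ`. The integral with respect to
`ν` is written out through its Jordan decomposition. -/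
def IsBV (ρ : ℝ → ℝ) : Prop :=
  Integrable ρ ∧
    ∃ ν : SignedMeasure ℝ, ∀ φ : ℝ → ℝ, ContDiff ℝ (⊤ : ℕ∞) φ → HasCompactSupport φ →
      ∫ t, φ t ∂ν.toJordanDecomposition.posPart - ∫ t, φ t ∂ν.toJordanDecomposition.negPart
        = -∫ t, ρ t * deriv φ t

/-- `ρ` is a density of `μ` with respect to Lebesgue measure. -/
def IsDensity (μ : Measure ℝ) (ρ : ℝ → ℝ) : Prop :=
  (∀ᵐ t, 0 ≤ ρ t) ∧ μ = volume.withDensity (fun t => ENNReal.ofReal (ρ t))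

/-- The space `Ω_Γ` of configurations `(ω_k)_{k ∈ Γ}` with all `ω_k` in the support of `μ`. -/
def confOn {d : ℕ} (μ : Measure ℝ) (Γ : Set (Site d)) : Set (Γ → ℝ) :=
  {ω | ∀ k, ω k ∈ μ.support}

/-- The space `Ω` of configurations `(ω_k)_{k ∈ ℤ^d}` with all `ω_k` in the support of `μ`. -/
def conf (d : ℕ) (μ : Measure ℝ) : Set (Site d → ℝ) :=
  {ω | ∀ k, ω k ∈ μ.support}

/-- The product measure `ℙ = ⨂_{k ∈ ℤ^d} μ`, as a measure on `ℝ^{ℤ^d}` (it is carried by `Ω`). -/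
def prodMeasure (d : ℕ) (μ : Measure ℝ) [IsProbabilityMeasure μ] : Measure (Site d → ℝ) :=
  Measure.infinitePi (fun _ : Site d => μ)

/-! ### The operators -/

/-- The sites `y` with `‖x - y‖₁ = 1`; they all lie in the box `[x - 1, x + 1]`. -/
def neighbors {d : ℕ} (x : Site d) : Finset (Site d) :=
  (Finset.Icc (x - 1) (x + 1)).filter (fun y => norm1 (x - y) = 1)

/-- The negative discrete Laplacian, `(h₀ ψ) x = ∑_{‖x - y‖₁ = 1} (ψ x - ψ y)`. -/
def freeOp (d : ℕ) : (Site d → ℂ) →ₗ[ℂ] (Site d → ℂ) where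
  toFun ψ x := ∑ y ∈ neighbors x, (ψ x - ψ y)
  map_add' ψ φ := by
    funext x
    simp only [Pi.add_apply, ← Finset.sum_add_distrib]
    exact Finset.sum_congr rfl fun y _ => by ring
  map_smul' c ψ := by
    funext x
    simp only [Pi.smul_apply, smul_eq_mul, RingHom.id_apply, Finset.mul_sum]
    exact Finset.sum_congr rfl fun y _ => by ring

/-- The potential `v_ω x = ∑ₖ ω_k u (x - k)`. -/
def potential {d : ℕ} (u : Site d → ℝ) (ω : Site d → ℝ) (x : Site d) : ℝ :=
  ∑' k : Site d, ω k * u (x - k)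

/-- The multiplication operator by `v_ω`. -/
def potentialOp {d : ℕ} (u : Site d → ℝ) (ω : Site d → ℝ) :
    (Site d → ℂ) →ₗ[ℂ] (Site d → ℂ) where
  toFun ψ x := (potential u ω x : ℂ) * ψ x
  map_add' ψ φ := by
    funext x
    simp only [Pi.add_apply, mul_add]
  map_smul' c ψ := by
    funext x
    simp only [Pi.smul_apply, smul_eq_mul, RingHom.id_apply]
    ring

/-- The compression `π_Λ T ι_Λ` of an operator to `Λ`: extend by zero, apply `T`, restrict. -/
def compress {d : ℕ} (Λ : Set (Site d)) (T : (Site d → ℂ) →ₗ[ℂ] (Site d → ℂ)) :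
    Module.End ℂ (Λ → ℂ) :=
  LinearMap.funLeft ℂ ℂ (Subtype.val : Λ → Site d) ∘ₗ T ∘ₗ
    Function.ExtendByZero.linearMap ℂ (Subtype.val : Λ → Site d)

/-- The restriction `h_ω^Λ = π_Λ h₀ ι_Λ + π_Λ v_ω ι_Λ`. For finite `Λ` the space `Λ → ℂ` is
`ℓ²(Λ)` as a vector space, and only the spectrum of the operator is used. -/
def boxOp {d : ℕ} (u : Site d → ℝ) (Λ : Set (Site d)) (ω : Site d → ℝ) :
    Module.End ℂ (Λ → ℂ) :=
  compress Λ (freeOp d) + compress Λ (potentialOp u ω)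

/-! ### The uniform distance of two spectra -/

/-- The distance `d(A, B) = inf {|a - b| : a ∈ A, b ∈ B}` of two sets. -/
def setDist (A B : Set ℂ) : ℝ≥0∞ := ⨅ a ∈ A, ⨅ b ∈ B, edist a b

open Classical in
/-- The configuration `(ω, ω^⊥)` made of `ω` on `Γ` and `ω^⊥` on the complement of `Γ`. -/
def glue {d : ℕ} (Γ : Set (Site d)) (ω : Γ → ℝ) (ω' : (Γᶜ : Set (Site d)) → ℝ) : Site d → ℝ :=
  fun k => if h : k ∈ Γ then ω ⟨k, h⟩ else ω' ⟨k, h⟩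

/-- The uniform distance of the spectra of `h_ω^{Λ₁}` and `h_ω^{Λ₂}`: the infimum of the distance
of the spectra when the couplings outside `Γ₁` for the first operator and outside `Γ₂` for the
second one are varied, independently of each other, over the support of `μ`. -/
def unifDist {d : ℕ} (u : Site d → ℝ) (μ : Measure ℝ) (Λ₁ Γ₁ Λ₂ Γ₂ : Set (Site d))
    (ω : Site d → ℝ) : ℝ≥0∞ :=
  ⨅ ω₁ ∈ confOn μ Γ₁ᶜ, ⨅ ω₂ ∈ confOn μ Γ₂ᶜ,
    setDist (spectrum ℂ (boxOp u Λ₁ (glue Γ₁ (Γ₁.domRestrict ω) ω₁)))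
      (spectrum ℂ (boxOp u Λ₂ (glue Γ₂ (Γ₂.domRestrict ω) ω₂)))

/-- The event that the uniform distance of the spectra for the cubes of radii `l₁`, `l₂` around
`x`, `y`, with enlarged cubes of radii `4 l₁`, `4 l₂`, is less than `ε`. -/
def resonanceEvent {d : ℕ} (u : Site d → ℝ) (μ : Measure ℝ) (x y : Site d) (l₁ l₂ ε : ℝ) :
    Set (Site d → ℝ) :=
  {ω | ω ∈ conf d μ ∧
    unifDist u μ (cube l₁ x) (cube (4 * l₁) x) (cube l₂ y) (cube (4 * l₂) y) ω
      < ENNReal.ofReal ε}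

end AlloyType

end

/-!
The leading index is what makes a monotone family of couplings available. Let `c = (D^{I₀} F)(1)`
and let `w` be the product of the falling factorials of orders `I₀`. Vandermonde's identity and the
vanishing of the lower derivatives give `∑ₖ w (k - y) u (x - k) = c` for every `x`: shifting the
couplings along `w (· - y) / c` raises the potential by a constant everywhere. By exponential decay,
once `l₂` is large, the shift restricted to the cube of radius `4 l₂` around `y` still gives
at least half of this raise inside the cube of radius `l₂`.

Replacing the couplings outside the enlarged cubes by zero moves the ordered eigenvalues by at most
a multiple of `exp (-3 min l₁ l₂ α / 2)`, uniformly in the replaced couplings. Afterwards the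
spectrum on the first cube does not depend on the couplings near the second one. Shifting the latter
by `4 ε w (· - y) / c` raises all eigenvalues on the second cube by `2 ε`, so the event that a fixed
one of them is `ε`-close to a fixed eigenvalue on the first cube lies in the difference of a set and
its translate. Since the density has bounded variation, the probability of a set changes under
translation by at most the variation times the `ℓ¹`-norm of the shift. Summing over all pairs of
eigenvalues gives the bound.
-/

namespace AlloyType

/-! ### Comparison of ordered eigenvalues -/

section EigenvalueComparison

variable {𝕜 E : Type*} [RCLike 𝕜] [NormedAddCommGroup E] [InnerProductSpace 𝕜 E]
  [FiniteDimensional 𝕜 E] {S T : E →ₗ[𝕜] E} {n : ℕ}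

lemma re_inner_apply_self_eq_sum_eigenvalues (hS : S.IsSymmetric)
    (hn : Module.finrank 𝕜 E = n) (v : E) :
    RCLike.re (inner 𝕜 (S v) v) =
      ∑ j, hS.eigenvalues hn j * ‖inner 𝕜 (hS.eigenvectorBasis hn j) v‖ ^ 2 := by
  rw [← (hS.eigenvectorBasis hn).sum_inner_mul_inner, map_sum]
  refine Finset.sum_congr rfl fun j _ => ?_
  rw [hS v, hS.apply_eigenvectorBasis, inner_smul_right, mul_assoc,
    ← inner_conj_symm v, RCLike.conj_mul]
  norm_cast

lemma eigenvalues_mul_norm_sq_le_re_inner (hS : S.IsSymmetric) (hn : Module.finrank 𝕜 E = n)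
    {i : Fin n} {v : E} (hv : ∀ j, i < j → inner 𝕜 (hS.eigenvectorBasis hn j) v = 0) :
    hS.eigenvalues hn i * ‖v‖ ^ 2 ≤ RCLike.re (inner 𝕜 (S v) v) := by
  rw [re_inner_apply_self_eq_sum_eigenvalues hS hn,
    ← (hS.eigenvectorBasis hn).sum_sq_norm_inner_right, Finset.mul_sum]
  refine Finset.sum_le_sum fun j _ => ?_
  rcases le_or_gt j i with hj | hj
  · exact mul_le_mul_of_nonneg_right (hS.eigenvalues_antitone hn hj) (by positivity)
  · simp [hv j hj]

lemma re_inner_le_eigenvalues_mul_norm_sq (hT : T.IsSymmetric) (hn : Module.finrank 𝕜 E = n)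
    {i : Fin n} {v : E} (hv : ∀ j, j < i → inner 𝕜 (hT.eigenvectorBasis hn j) v = 0) :
    RCLike.re (inner 𝕜 (T v) v) ≤ hT.eigenvalues hn i * ‖v‖ ^ 2 := by
  rw [re_inner_apply_self_eq_sum_eigenvalues hT hn,
    ← (hT.eigenvectorBasis hn).sum_sq_norm_inner_right, Finset.mul_sum]
  refine Finset.sum_le_sum fun j _ => ?_
  rcases le_or_gt i j with hj | hj
  · exact mul_le_mul_of_nonneg_right (hT.eigenvalues_antitone hn hj) (by positivity)
  · simp [hv j hj]

lemma exists_ne_zero_forall_ne_inner_eq_zero (hn : Module.finrank 𝕜 E = n) (i : Fin n)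
    (w : Fin n → E) : ∃ v : E, v ≠ 0 ∧ ∀ j, j ≠ i → inner 𝕜 (w j) v = 0 := by
  let f : E →ₗ[𝕜] ({j : Fin n // j ≠ i} → 𝕜) := LinearMap.pi fun j => (innerSL 𝕜 (w j)).toLinearMap
  have hf : LinearMap.ker f ≠ ⊥ := by
    apply LinearMap.ker_ne_bot_of_finrank_lt
    rw [hn, Module.finrank_fintype_fun_eq_card]
    simpa using Fintype.card_subtype_lt (p := fun j => j ≠ i) (x := i) (by simp)
  obtain ⟨v, hv, hv0⟩ := (Submodule.ne_bot_iff _).1 hf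
  exact ⟨v, hv0, fun j hj => congrFun (LinearMap.mem_ker.1 hv) ⟨j, hj⟩⟩

/-- Courant–Fischer: test both forms on a vector orthogonal to the eigenvectors of `S` above `i`
and to those of `T` below `i`. -/
theorem eigenvalues_add_le (hS : S.IsSymmetric) (hT : T.IsSymmetric)
    (hn : Module.finrank 𝕜 E = n) {t : ℝ}
    (h : ∀ v, RCLike.re (inner 𝕜 (S v) v) + t * ‖v‖ ^ 2 ≤ RCLike.re (inner 𝕜 (T v) v))
    (i : Fin n) : hS.eigenvalues hn i + t ≤ hT.eigenvalues hn i := by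
  obtain ⟨v, hv, horth⟩ := exists_ne_zero_forall_ne_inner_eq_zero hn i fun j =>
    if i < j then hS.eigenvectorBasis hn j else hT.eigenvectorBasis hn j
  have hlower := eigenvalues_mul_norm_sq_le_re_inner hS hn (i := i) (v := v) fun j hj => by
    simpa [hj] using horth j hj.ne'
  have hupper := re_inner_le_eigenvalues_mul_norm_sq hT hn (i := i) (v := v) fun j hj => by
    simpa [hj.not_gt] using horth j hj.ne
  refine le_of_mul_le_mul_right ?_ (by positivity : 0 < ‖v‖ ^ 2)
  linarith [h v]

variable {ι : Type*} [Fintype ι] [DecidableEq ι]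

lemma re_inner_toEuclideanLin_add_diagonal (A : Matrix ι ι 𝕜) (v : ι → ℝ)
    (f : EuclideanSpace 𝕜 ι) :
    RCLike.re (inner 𝕜 (Matrix.toEuclideanLin (A + Matrix.diagonal fun x => (v x : 𝕜)) f) f) =
      RCLike.re (inner 𝕜 (Matrix.toEuclideanLin A f) f) + ∑ x, v x * ‖f x‖ ^ 2 := by
  rw [map_add, LinearMap.add_apply, inner_add_left, map_add, add_right_inj, PiLp.inner_apply,
    map_sum]
  refine Finset.sum_congr rfl fun x _ => ?_
  simp only [Matrix.toLpLin_apply, Matrix.mulVec_diagonal, ← smul_eq_mul (v x : 𝕜),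
    inner_smul_left, inner_self_eq_norm_sq_to_K, RCLike.conj_ofReal]
  rw [smul_eq_mul, RCLike.re_ofReal_mul]
  norm_cast

theorem eigenvalues₀_add_diagonal_add_le {A : Matrix ι ι 𝕜} {v w : ι → ℝ}
    (hv : (A + Matrix.diagonal fun x => (v x : 𝕜)).IsHermitian)
    (hw : (A + Matrix.diagonal fun x => (w x : 𝕜)).IsHermitian)
    {t : ℝ} (h : ∀ x, v x + t ≤ w x) (i : Fin (Fintype.card ι)) :
    hv.eigenvalues₀ i + t ≤ hw.eigenvalues₀ i := by
  refine eigenvalues_add_le _ _ _ (fun f => ?_) i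
  rw [re_inner_toEuclideanLin_add_diagonal, re_inner_toEuclideanLin_add_diagonal,
    EuclideanSpace.norm_sq_eq, Finset.mul_sum, add_assoc, ← Finset.sum_add_distrib]
  gcongr with x
  rw [← add_mul]
  exact mul_le_mul_of_nonneg_right (h x) (by positivity)

end EigenvalueComparison

/-! ### Eigenvalues of the restricted operators -/

section Box

variable {d : ℕ}

lemma norm1_neg (k : Site d) : norm1 (-k) = norm1 k := by simp [norm1]

lemma abs_apply_le_norm1 (k : Site d) (r : Fin d) : |k r| ≤ norm1 k :=
  Finset.single_le_sum (f := fun r => |k r|) (fun _ _ => abs_nonneg _) (Finset.mem_univ r)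

lemma mem_neighbors {x y : Site d} : y ∈ neighbors x ↔ norm1 (x - y) = 1 := by
  simp only [neighbors, Finset.mem_filter, Finset.mem_Icc, and_iff_right_iff_imp]
  intro h
  have hr : ∀ r, |x r - y r| ≤ 1 := fun r => h ▸ abs_apply_le_norm1 (x - y) r
  constructor <;> intro r <;> have := abs_le.1 (hr r) <;> simp <;> lia

lemma mem_neighbors_comm {x y : Site d} : y ∈ neighbors x ↔ x ∈ neighbors y := by
  rw [mem_neighbors, mem_neighbors, ← norm1_neg, neg_sub]

variable (Λ : Set (Site d))

lemma compress_apply_apply (T : (Site d → ℂ) →ₗ[ℂ] (Site d → ℂ)) (ψ : Λ → ℂ) (x : Λ) :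
    compress Λ T ψ x = T (Function.extend Subtype.val ψ 0) x := rfl

lemma extend_subtype_val_single (y : Λ) :
    Function.extend Subtype.val (Pi.single y 1) 0 = (Pi.single (y : Site d) 1 : Site d → ℂ) := by
  funext z
  by_cases hz : z ∈ Λ
  · rw [Subtype.val_injective.extend_apply (Pi.single y (1 : ℂ)) 0 ⟨z, hz⟩]
    simp [Pi.single_apply, Subtype.ext_iff]
  · rw [Function.extend_apply' _ _ _ (by rintro ⟨a, rfl⟩; exact hz a.2),
      Pi.single_eq_of_ne (by rintro rfl; exact hz y.2), Pi.zero_apply]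

variable [Fintype Λ]

lemma toMatrix'_compress_freeOp_apply (x y : Λ) :
    LinearMap.toMatrix' (compress Λ (freeOp d)) x y =
      (if x = y then ((neighbors (x : Site d)).card : ℂ) else 0)
        - if (y : Site d) ∈ neighbors (x : Site d) then 1 else 0 := by
  rw [LinearMap.toMatrix'_apply, compress_apply_apply, extend_subtype_val_single]
  simp [freeOp, Finset.sum_sub_distrib, Pi.single_apply, Subtype.ext_iff]

lemma isHermitian_toMatrix'_compress_freeOp :
    (LinearMap.toMatrix' (compress Λ (freeOp d))).IsHermitian := by
  ext x y
  rw [Matrix.conjTranspose_apply, toMatrix'_compress_freeOp_apply, toMatrix'_compress_freeOp_apply]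
  simp only [mem_neighbors_comm (x := (y : Site d))]
  rcases eq_or_ne x y with rfl | h
  · by_cases hx : (x : Site d) ∈ neighbors (x : Site d) <;> simp [hx]
  · simp [h, h.symm, apply_ite]

lemma toMatrix'_compress_potentialOp (u ω : Site d → ℝ) :
    LinearMap.toMatrix' (compress Λ (potentialOp u ω)) =
      Matrix.diagonal fun x : Λ => (potential u ω x : ℂ) := by
  ext x y
  rw [LinearMap.toMatrix'_apply, compress_apply_apply, extend_subtype_val_single]
  simp [potentialOp, Pi.single_apply, Matrix.diagonal_apply, Subtype.ext_iff]

/-- The matrix on `ℓ²(Λ)` of the restricted free operator `π_Λ h₀ ι_Λ` plus multiplication by an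
arbitrary potential `v : Λ → ℝ`. -/
noncomputable def boxMatrix (v : Λ → ℝ) : Matrix Λ Λ ℂ :=
  LinearMap.toMatrix' (compress Λ (freeOp d)) + Matrix.diagonal fun x => (v x : ℂ)

lemma isHermitian_boxMatrix (v : Λ → ℝ) : (boxMatrix Λ v).IsHermitian :=
  (isHermitian_toMatrix'_compress_freeOp Λ).add
    (Matrix.isHermitian_diagonal_of_self_adjoint _ (funext fun _ => Complex.conj_ofReal _))

lemma toMatrix'_boxOp (u ω : Site d → ℝ) :
    LinearMap.toMatrix' (boxOp u Λ ω) = boxMatrix Λ fun x => potential u ω x := by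
  rw [boxOp, map_add, toMatrix'_compress_potentialOp, boxMatrix]

/-- The eigenvalues, in decreasing order and with multiplicity, of the free operator on `Λ` plus
the potential `v`. -/
noncomputable def boxEigenvalues (v : Λ → ℝ) : Fin (Fintype.card Λ) → ℝ :=
  (isHermitian_boxMatrix Λ v).eigenvalues₀

lemma boxEigenvalues_add_le {v w : Λ → ℝ} {t : ℝ} (h : ∀ x, v x + t ≤ w x)
    (i : Fin (Fintype.card Λ)) : boxEigenvalues Λ v i + t ≤ boxEigenvalues Λ w i :=
  eigenvalues₀_add_diagonal_add_le (isHermitian_boxMatrix Λ v) (isHermitian_boxMatrix Λ w) h i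

lemma abs_boxEigenvalues_sub_le {v w : Λ → ℝ} {t : ℝ} (h : ∀ x, |v x - w x| ≤ t)
    (i : Fin (Fintype.card Λ)) : |boxEigenvalues Λ v i - boxEigenvalues Λ w i| ≤ t := by
  have hvw := boxEigenvalues_add_le Λ (v := v) (w := w) (t := -t)
    (fun x => by linarith [(abs_le.1 (h x)).2]) i
  have hwv := boxEigenvalues_add_le Λ (v := w) (w := v) (t := -t)
    (fun x => by linarith [(abs_le.1 (h x)).1]) i
  rw [abs_le]
  constructor <;> linarith

lemma continuous_boxEigenvalues (i : Fin (Fintype.card Λ)) :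
    Continuous fun v : Λ → ℝ => boxEigenvalues Λ v i := by
  refine (LipschitzWith.of_dist_le_mul (K := 1) fun v w => ?_).continuous
  rw [NNReal.coe_one, one_mul, Real.dist_eq]
  exact abs_boxEigenvalues_sub_le Λ (fun x => dist_le_pi_dist v w x) i

lemma spectrum_boxOp_subset_range (u ω : Site d → ℝ) :
    spectrum ℂ (boxOp u Λ ω) ⊆
      Set.range fun i => (boxEigenvalues Λ (fun x => potential u ω x) i : ℂ) := by
  rw [← AlgEquiv.spectrum_eq LinearMap.toMatrixAlgEquiv',
    show LinearMap.toMatrixAlgEquiv' (boxOp u Λ ω) = _ from toMatrix'_boxOp Λ u ω,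
    (isHermitian_boxMatrix Λ _).spectrum_eq_image_range]
  rintro _ ⟨_, ⟨i, rfl⟩, rfl⟩
  exact ⟨_, rfl⟩

end Box

/-! ### Translates of measures with a density of bounded variation -/

open scoped NNReal

section SmoothTestFunctions

variable {E : Type*} [NormedAddCommGroup E] [NormedSpace ℝ E] [FiniteDimensional ℝ E]

open scoped Manifold in
lemma exists_contDiff_one_on_compact_zero_off_open {K U : Set E} (hK : IsCompact K)
    (hU : IsOpen U) (hKU : K ⊆ U) :
    ∃ φ : E → ℝ, ContDiff ℝ (⊤ : ℕ∞) φ ∧ HasCompactSupport φ ∧ (∀ t, φ t ∈ Set.Icc 0 1) ∧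
      (∀ t ∈ K, φ t = 1) ∧ ∀ t ∉ U, φ t = 0 := by
  obtain ⟨L, hL, hKL, hLU⟩ := exists_compact_between hK hU hKU
  obtain ⟨φ, hφK, hφL, hφ⟩ :=
    exists_contMDiffMap_one_nhds_of_subset_interior (n := ⊤) 𝓘(ℝ, E) hK.isClosed hKL
  exact ⟨φ, φ.contMDiff.contDiff, HasCompactSupport.intro hL hφL, hφ,
    fun t ht => hφK.self_of_nhdsSet t ht, fun t ht => hφL t fun h => ht (hLU h)⟩

variable [MeasurableSpace E] [BorelSpace E]

lemma measure_le_add_of_forall_contDiff {μ ν : Measure E} [IsFiniteMeasure μ] [IsFiniteMeasure ν]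
    {c : ℝ}
    (h : ∀ φ : E → ℝ, ContDiff ℝ (⊤ : ℕ∞) φ → HasCompactSupport φ → (∀ t, φ t ∈ Set.Icc 0 1) →
      ∫ t, φ t ∂μ ≤ ∫ t, φ t ∂ν + c)
    {S : Set E} (hS : MeasurableSet S) : μ S ≤ ν S + ENNReal.ofReal c := by
  rw [hS.measure_eq_iSup_isCompact_of_ne_top (measure_ne_top μ S), S.measure_eq_iInf_isOpen ν]
  simp only [ENNReal.iInf_add]
  refine iSup₂_le fun K hKS => iSup_le fun hK => le_iInf₂ fun U hSU => le_iInf fun hU => ?_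
  obtain ⟨φ, hφ, hφc, hφI, hφK, hφU⟩ :=
    exists_contDiff_one_on_compact_zero_off_open hK hU (hKS.trans hSU)
  have hK_le : μ.real K ≤ ∫ t, φ t ∂μ := by
    rw [← integral_indicator_one hK.measurableSet]
    refine integral_mono ((integrable_const 1).indicator hK.measurableSet)
      (hφ.continuous.integrable_of_hasCompactSupport hφc) fun t => ?_
    by_cases ht : t ∈ K
    · simp [ht, hφK t ht]
    · simpa [ht] using (hφI t).1
  have hle_U : ∫ t, φ t ∂ν ≤ ν.real U := by
    rw [← integral_indicator_one hU.measurableSet]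
    refine integral_mono (hφ.continuous.integrable_of_hasCompactSupport hφc)
      ((integrable_const 1).indicator hU.measurableSet) fun t => ?_
    by_cases ht : t ∈ U
    · simpa [ht] using (hφI t).2
    · simp [ht, hφU t ht]
  rw [← ofReal_measureReal (μ := μ), ← ofReal_measureReal (μ := ν)]
  exact (ENNReal.ofReal_le_ofReal (by linarith [h φ hφ hφc hφI])).trans ENNReal.ofReal_add_le

end SmoothTestFunctions

section WindowIntegral

variable {g : ℝ → ℝ}

lemma hasDerivAt_integral_window (hg : Continuous g) (h t : ℝ) :
    HasDerivAt (fun t => ∫ s in t..t + h, g s) (g (t + h) - g t) t := by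
  have hprim : ∀ t, HasDerivAt (fun t => ∫ s in (0 : ℝ)..t, g s) (g t) t := fun t =>
    (hg.integral_hasStrictDerivAt 0 t).hasDerivAt
  simpa only [intervalIntegral.integral_interval_sub_left (hg.intervalIntegrable _ _)
    (hg.intervalIntegrable _ _)] using ((hprim (t + h)).comp_add_const t h).fun_sub (hprim t)

lemma contDiff_integral_window (hg : ContDiff ℝ (⊤ : ℕ∞) g) (h : ℝ) :
    ContDiff ℝ (⊤ : ℕ∞) fun t => ∫ s in t..t + h, g s := by
  have hderiv := hasDerivAt_integral_window hg.continuous h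
  rw [contDiff_infty_iff_deriv, funext fun t => (hderiv t).deriv]
  exact ⟨fun t => (hderiv t).differentiableAt, (hg.comp (contDiff_id.add contDiff_const)).sub hg⟩

open scoped Pointwise in
lemma hasCompactSupport_integral_window (hg : HasCompactSupport g) (h : ℝ) :
    HasCompactSupport fun t => ∫ s in t..t + h, g s := by
  refine HasCompactSupport.intro (IsCompact.add (isCompact_uIcc (a := 0) (b := -h)) hg)
    fun t ht => ?_
  rw [intervalIntegral.integral_congr (g := fun _ => 0), intervalIntegral.integral_zero]
  intro s hs
  by_contra hne
  refine ht (Set.mem_add.2 ⟨t - s, ?_, s, subset_tsupport g hne, by ring⟩)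
  rcases Set.mem_uIcc.1 hs with hs | hs <;> rw [Set.mem_uIcc]
  · exact .inr ⟨by linarith, by linarith⟩
  · exact .inl ⟨by linarith, by linarith⟩

lemma abs_integral_window_le {M : ℝ} (hM : ∀ t, |g t| ≤ M) (h t : ℝ) :
    |∫ s in t..t + h, g s| ≤ M * |h| := by
  simpa using intervalIntegral.norm_integral_le_of_norm_le_const (a := t) (b := t + h)
    (f := g) (C := M) (fun s _ => hM s)

end WindowIntegral

/-- `V` bounds the total variation of the distributional derivative of `ρ`, as a functional on test
functions with the supremum norm. -/
def VariationBound (ρ : ℝ → ℝ) (V : ℝ≥0) : Prop :=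
  ∀ (φ : ℝ → ℝ) (M : ℝ), ContDiff ℝ (⊤ : ℕ∞) φ → HasCompactSupport φ → (∀ t, |φ t| ≤ M) →
    |∫ t, ρ t * deriv φ t| ≤ M * V

lemma IsBV.exists_variationBound {ρ : ℝ → ℝ} (hρ : IsBV ρ) :
    ∃ V : ℝ≥0, VariationBound ρ V := by
  obtain ⟨-, ν, hν⟩ := hρ
  refine ⟨(ν.toJordanDecomposition.posPart Set.univ).toNNReal +
    (ν.toJordanDecomposition.negPart Set.univ).toNNReal, fun φ M hφ hφc hM => ?_⟩
  rw [← abs_neg, ← hν φ hφ hφc, NNReal.coe_add, mul_add]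
  exact (abs_sub _ _).trans (add_le_add
    (norm_integral_le_of_norm_le_const (f := φ) (Filter.Eventually.of_forall hM))
    (norm_integral_le_of_norm_le_const (f := φ) (Filter.Eventually.of_forall hM)))

/-- The measure of a set changes by at most `V |h|` when the set is translated by `h`. -/
def TranslationLipschitz (μ : Measure ℝ) (V : ℝ≥0) : Prop :=
  ∀ (h : ℝ) (S : Set ℝ), MeasurableSet S → μ S ≤ μ ((· + h) ⁻¹' S) + V * ‖h‖ₑ

section BoundedVariation

variable {μ : Measure ℝ} {ρ : ℝ → ℝ} {V : ℝ≥0}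

lemma VariationBound.abs_integral_mul_translate_sub_le (hV : VariationBound ρ V) {g : ℝ → ℝ}
    {M : ℝ} (hg : ContDiff ℝ (⊤ : ℕ∞) g) (hc : HasCompactSupport g) (hM : ∀ t, |g t| ≤ M)
    (h : ℝ) : |∫ t, ρ t * (g (t + h) - g t)| ≤ M * |h| * V := by
  simpa only [fun t => (hasDerivAt_integral_window hg.continuous h t).deriv] using
    hV _ _ (contDiff_integral_window hg h) (hasCompactSupport_integral_window hc h)
      (abs_integral_window_le hM h)

lemma IsDensity.integral_eq (hμ : IsDensity μ ρ) (hρ : AEMeasurable ρ) (g : ℝ → ℝ) :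
    ∫ t, g t ∂μ = ∫ t, ρ t * g t := by
  rw [hμ.2, integral_withDensity_eq_integral_toReal_smul₀ hρ.ennreal_ofReal
    (Filter.Eventually.of_forall fun t => ENNReal.ofReal_lt_top)]
  refine integral_congr_ae ?_
  filter_upwards [hμ.1] with t ht
  rw [ENNReal.toReal_ofReal ht, smul_eq_mul]

theorem IsDensity.translationLipschitz [IsFiniteMeasure μ] (hμ : IsDensity μ ρ)
    (hρ : Integrable ρ) (hV : VariationBound ρ V) : TranslationLipschitz μ V := by
  intro h S hS
  have hadd : Measurable fun t : ℝ => t + h := measurable_add_const h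
  rw [← Measure.map_apply hadd hS, ← Real.enorm_abs h, Real.enorm_of_nonneg (abs_nonneg h),
    ← ENNReal.ofReal_coe_nnreal, ← ENNReal.ofReal_mul V.coe_nonneg]
  refine measure_le_add_of_forall_contDiff (fun φ hφ hφc hφI => ?_) hS
  have hint : ∀ s, Integrable fun t => ρ t * φ (t + s) := fun s =>
    hρ.mul_bdd (hφ.continuous.comp (continuous_add_const s)).aestronglyMeasurable
      (Filter.Eventually.of_forall fun t =>
        abs_le.2 ⟨by linarith [(hφI (t + s)).1], (hφI (t + s)).2⟩)
  have hvar := hV.abs_integral_mul_translate_sub_le hφ hφc (M := 1)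
    (fun t => abs_le.2 ⟨by linarith [(hφI t).1], (hφI t).2⟩) h
  simp only [mul_sub] at hvar
  rw [integral_sub (hint h) (by simpa using hint 0), ← hμ.integral_eq hρ.1.aemeasurable,
    ← hμ.integral_eq hρ.1.aemeasurable] at hvar
  rw [integral_map hadd.aemeasurable hφ.continuous.aestronglyMeasurable]
  linarith [(abs_le.1 hvar).1]

end BoundedVariation

/-! ### Translates of product measures -/

section ProductMeasure

variable {ι : Type*} [DecidableEq ι]

lemma preimage_update_pi {X : ι → Type*} (k : ι) (s : Finset ι) (t : ∀ i, Set (X i)) :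
    (fun p : (∀ i, X i) × X k => Function.update p.1 k p.2) ⁻¹' Set.pi s t =
      Set.pi (s.erase k) t ×ˢ (if k ∈ s then t k else Set.univ) := by
  ext p
  simp only [Set.mem_preimage, Set.mem_pi, Finset.mem_coe, Set.mem_prod, Finset.mem_erase]
  constructor
  · intro h
    refine ⟨fun i hi => by simpa [hi.1] using h i hi.2, ?_⟩
    split_ifs with hk
    · simpa using h k hk
    · trivial
  · rintro ⟨hne, hk⟩ i hi
    rcases eq_or_ne i k with rfl | hik
    · simpa [hi] using hk
    · simpa [hik] using hne i ⟨hik, hi⟩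

lemma infinitePi_map_update {X : ι → Type*} [∀ i, MeasurableSpace (X i)]
    (μ : ∀ i, Measure (X i)) [∀ i, IsProbabilityMeasure (μ i)] (k : ι) :
    ((Measure.infinitePi μ).prod (μ k)).map (fun p => Function.update p.1 k p.2) =
      Measure.infinitePi μ := by
  refine Measure.eq_infinitePi μ fun s t ht => ?_
  rw [Measure.map_apply measurable_update' (MeasurableSet.pi s.countable_toSet fun i _ => ht i),
    preimage_update_pi, Measure.prod_prod, Measure.infinitePi_pi μ fun i _ => ht i]
  split_ifs with hk
  · rw [Finset.prod_erase_mul _ _ hk]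
  · rw [measure_univ, mul_one, Finset.erase_eq_of_notMem hk]

lemma infinitePi_eq_lintegral_update {X : ι → Type*} [∀ i, MeasurableSpace (X i)]
    (μ : ∀ i, Measure (X i)) [∀ i, IsProbabilityMeasure (μ i)] (k : ι) {S : Set (∀ i, X i)}
    (hS : MeasurableSet S) :
    Measure.infinitePi μ S =
      ∫⁻ ω, μ k (Function.update ω k ⁻¹' S) ∂Measure.infinitePi μ := by
  nth_rw 1 [← infinitePi_map_update μ k]
  rw [Measure.map_apply measurable_update' hS, Measure.prod_apply (measurable_update' hS)]
  rfl

lemma add_single_preimage_update (ω : ι → ℝ) (k : ι) (h : ℝ) (S : Set (ι → ℝ)) :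
    Function.update ω k ⁻¹' ((· + Pi.single k h) ⁻¹' S) =
      (· + h) ⁻¹' (Function.update ω k ⁻¹' S) := by
  ext t
  simp only [Set.mem_preimage]
  rw [show Function.update ω k t + Pi.single k h = Function.update ω k (t + h) by
    ext i; rcases eq_or_ne i k with rfl | hik <;> simp [*]]

variable {μ : ι → Measure ℝ} [∀ i, IsProbabilityMeasure (μ i)] {V : ℝ≥0} {S : Set (ι → ℝ)}

lemma infinitePi_le_preimage_add_single (hμ : ∀ i, TranslationLipschitz (μ i) V)
    (hS : MeasurableSet S) (k : ι) (h : ℝ) :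
    Measure.infinitePi μ S ≤
      Measure.infinitePi μ ((· + Pi.single k h) ⁻¹' S) + V * ‖h‖ₑ := by
  have hadd : Measurable fun ω : ι → ℝ => ω + Pi.single k h := measurable_id.add_const _
  rw [infinitePi_eq_lintegral_update μ k hS, infinitePi_eq_lintegral_update μ k (hadd hS)]
  calc ∫⁻ ω, μ k (Function.update ω k ⁻¹' S) ∂Measure.infinitePi μ
    _ ≤ ∫⁻ ω, (μ k ((· + h) ⁻¹' (Function.update ω k ⁻¹' S)) + V * ‖h‖ₑ) ∂Measure.infinitePi μ :=
        lintegral_mono fun ω => hμ k h _ (measurable_update ω hS)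
    _ = _ := by
        rw [lintegral_add_right _ measurable_const, lintegral_const, measure_univ, mul_one]
        simp only [add_single_preimage_update]

theorem infinitePi_le_preimage_add_sum_single (hμ : ∀ i, TranslationLipschitz (μ i) V)
    (hS : MeasurableSet S) (s : Finset ι) (a : ι → ℝ) :
    Measure.infinitePi μ S ≤
      Measure.infinitePi μ ((· + ∑ k ∈ s, Pi.single k (a k)) ⁻¹' S) + V * ∑ k ∈ s, ‖a k‖ₑ := by
  induction s using Finset.induction_on with
  | empty => simp
  | insert k s hk ih =>
    have hadd : Measurable fun ω : ι → ℝ => ω + ∑ k ∈ s, Pi.single k (a k) :=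
      measurable_id.add_const _
    refine ih.trans ((add_le_add_left
      (infinitePi_le_preimage_add_single hμ (hadd hS) k (a k)) _).trans_eq ?_)
    simp only [Finset.sum_insert hk, mul_add, ← Set.preimage_comp, Function.comp_def, add_assoc]

end ProductMeasure

/-! ### Cubes and exponentially weighted sums -/

section Cube

variable {d : ℕ}

lemma cast_norm1 (k : Site d) : (norm1 k : ℝ) = ∑ r, |(k r : ℝ)| := by
  simp [norm1]

lemma norm1_nonneg (k : Site d) : 0 ≤ norm1 k :=
  Finset.sum_nonneg fun _ _ => abs_nonneg _

/-- The cube `cube l j` as a finite set. -/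
noncomputable def cubeFinset (l : ℝ) (j : Site d) : Finset (Site d) :=
  Fintype.piFinset fun r => Finset.Icc ⌈(j r : ℝ) - l⌉ ⌊(j r : ℝ) + l⌋

lemma mem_cubeFinset {l : ℝ} {j k : Site d} : k ∈ cubeFinset l j ↔ k ∈ cube l j := by
  simp only [cubeFinset, Fintype.mem_piFinset, Finset.mem_Icc, Int.ceil_le, Int.le_floor, cube,
    Set.mem_ofPred_eq]
  refine forall_congr' fun r => ?_
  rw [abs_le]
  constructor <;> rintro ⟨h1, h2⟩ <;> constructor <;> linarith

noncomputable instance (l : ℝ) (j : Site d) : Fintype (cube l j) :=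
  Fintype.ofFinset (cubeFinset l j) fun _ => mem_cubeFinset

lemma card_cubeFinset_le {l : ℝ} (hl : 0 ≤ l) (j : Site d) :
    ((cubeFinset l j).card : ℝ) ≤ (2 * l + 1) ^ d := by
  rw [cubeFinset, Fintype.card_piFinset, Nat.cast_prod]
  refine (Finset.prod_le_prod (fun _ _ => by positivity) (g := fun _ => 2 * l + 1)
    fun r _ => ?_).trans_eq (by simp)
  have hlen : ((⌊(j r : ℝ) + l⌋ + 1 - ⌈(j r : ℝ) - l⌉ : ℤ) : ℝ) ≤ 2 * l + 1 := by
    push_cast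
    linarith [Int.floor_le ((j r : ℝ) + l), Int.le_ceil ((j r : ℝ) - l)]
  rw [Int.card_Icc, ← Int.cast_natCast, Int.toNat_eq_max, Int.cast_max]
  exact max_le hlen (by push_cast; linarith)

lemma card_cube_le {l : ℝ} (hl : 0 ≤ l) (j : Site d) :
    (Fintype.card (cube l j) : ℝ) ≤ (2 * l + 1) ^ d := by
  rw [Fintype.card_ofFinset]
  exact card_cubeFinset_le hl j

lemma lt_norm1_sub_of_notMem_cube {l : ℝ} {x y k : Site d} (hx : x ∈ cube l y)
    (hk : k ∉ cube (4 * l) y) : 3 * l < norm1 (x - k) := by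
  simp only [cube, Set.mem_ofPred_eq, not_forall, not_le] at hx hk
  obtain ⟨r, hr⟩ := hk
  have hcoord : |(x r : ℝ) - k r| ≤ norm1 (x - k) := by
    exact_mod_cast abs_apply_le_norm1 (x - k) r
  rw [abs_sub_comm] at hcoord
  linarith [abs_sub_le (k r : ℝ) (x r) (y r), hx r]

end Cube

section ExpSum

variable {d : ℕ} {β : ℝ}

lemma exp_mul_norm1 (β : ℝ) (k : Site d) :
    Real.exp (β * norm1 k) = ∏ r, Real.exp (β * |(k r : ℝ)|) := by
  rw [cast_norm1, Finset.mul_sum, Real.exp_sum]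

lemma summable_exp_neg_mul_abs_int (hβ : 0 < β) :
    Summable fun n : ℤ => Real.exp (-β * |(n : ℝ)|) := by
  have hnat : Summable fun n : ℕ => Real.exp (-β * (n : ℝ)) := by
    simpa [mul_comm] using Real.summable_exp_nat_mul_iff.2 (neg_lt_zero.2 hβ)
  exact Summable.of_nat_of_neg (by simpa using hnat) (by simpa using hnat)

lemma summable_exp_neg_mul_norm1 (hβ : 0 < β) :
    Summable fun k : Site d => Real.exp (-β * norm1 k) := by
  simp only [exp_mul_norm1]
  refine summable_of_sum_le (c := ∏ _r : Fin d, ∑' n : ℤ, Real.exp (-β * |(n : ℝ)|))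
    (fun k => by positivity) fun s => ?_
  have hs : s ⊆ Fintype.piFinset fun r => s.image fun k => k r := fun k hk =>
    Fintype.mem_piFinset.2 fun r => Finset.mem_image_of_mem _ hk
  refine (Finset.sum_le_sum_of_subset_of_nonneg hs fun _ _ _ => by positivity).trans ?_
  rw [← Finset.prod_univ_sum (t := fun r => s.image fun k => k r)
    (f := fun _ (n : ℤ) => Real.exp (-β * |(n : ℝ)|))]
  exact Finset.prod_le_prod (fun _ _ => by positivity)
    fun r _ => (summable_exp_neg_mul_abs_int hβ).sum_le_tsum _ fun _ _ => (Real.exp_pos _).le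

/-- The constant `∑ₖ exp (-β ‖k‖₁)`, which bounds all the exponential tails. -/
noncomputable def expSum (d : ℕ) (β : ℝ) : ℝ := ∑' k : Site d, Real.exp (-β * norm1 k)

lemma expSum_nonneg (d : ℕ) (β : ℝ) : 0 ≤ expSum d β := tsum_nonneg fun _ => (Real.exp_pos _).le

lemma hasSum_exp_neg_mul_norm1_sub (hβ : 0 < β) (x : Site d) :
    HasSum (fun k : Site d => Real.exp (-β * norm1 (x - k))) (expSum d β) :=
  (Equiv.subLeft x).hasSum_iff.2 (summable_exp_neg_mul_norm1 hβ).hasSum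

lemma abs_sub_sum_le_of_exp_bound (hβ : 0 < β) {f : Site d → ℝ} {c K : ℝ}
    (hf : HasSum f c) {Γ : Finset (Site d)} (hK : 0 ≤ K) (x : Site d)
    (hΓ : ∀ k ∉ Γ, |f k| ≤ K * Real.exp (-β * norm1 (x - k))) :
    |c - ∑ k ∈ Γ, f k| ≤ K * expSum d β := by
  have hpartial : HasSum ((Γ : Set (Site d)).indicator f) (∑ k ∈ Γ, f k) := by
    rw [← Finset.sum_indicator_subset f (Finset.Subset.refl Γ)]
    exact hasSum_sum_of_ne_finset_zero fun k hk => Set.indicator_of_notMem (by simpa using hk) f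
  rw [← (hf.sub hpartial).tsum_eq, ← Real.norm_eq_abs]
  refine tsum_of_norm_bounded ((hasSum_exp_neg_mul_norm1_sub hβ x).mul_left K) fun k => ?_
  by_cases hk : k ∈ Γ
  · simp only [Set.indicator_of_mem (Finset.mem_coe.2 hk), sub_self, norm_zero]
    positivity
  · simpa [hk] using hΓ k hk

lemma exists_add_pow_le_mul_exp {b c : ℝ} (hb : 0 ≤ b) (hc : 0 < c) (j : ℕ) :
    ∃ K, 0 < K ∧ ∀ t, 0 ≤ t → (t + b) ^ j ≤ K * Real.exp (c * t) := by
  refine ⟨j.factorial / c ^ j * Real.exp (c * b), by positivity, fun t ht => ?_⟩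
  have h := Real.pow_div_factorial_le_exp (c * (t + b)) (by positivity) j
  rw [div_le_iff₀ (by positivity), mul_pow] at h
  rw [div_mul_eq_mul_div, div_mul_eq_mul_div, le_div_iff₀ (by positivity), mul_assoc,
    ← Real.exp_add, ← mul_add, add_comm b t]
  linarith

end ExpSum

/-! ### Falling factorials -/

section FallFact

/-- The falling factorial `n (n - 1) ⋯ (n - j + 1)` of a possibly negative integer. -/
noncomputable def fallFact (n : ℤ) (j : ℕ) : ℤ := (descPochhammer ℤ j).eval n

lemma fallFact_zero (n : ℤ) : fallFact n 0 = 1 := by simp [fallFact]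

lemma fallFact_succ (n : ℤ) (j : ℕ) : fallFact n (j + 1) = fallFact n j * (n - j) := by
  simp [fallFact, descPochhammer_succ_eval]

lemma fallFact_add (m n : ℤ) (i : ℕ) :
    fallFact (m + n) i = ∑ j ∈ Finset.Iic i, i.choose j * fallFact n (i - j) * fallFact m j := by
  have h := Ring.descPochhammer_smeval_add i (Commute.all m n)
  simp only [← Polynomial.eval_eq_smeval] at h
  rw [fallFact, h, Finset.Nat.sum_antidiagonal_eq_sum_range_succ fun j k =>
    (i.choose j : ℤ) * ((descPochhammer ℤ j).eval m * (descPochhammer ℤ k).eval n),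
    Nat.range_succ_eq_Iic]
  exact Finset.sum_congr rfl fun j _ => by simp only [fallFact]; ring

lemma abs_fallFact_le (n : ℤ) (j : ℕ) : |(fallFact n j : ℝ)| ≤ (|(n : ℝ)| + j) ^ j := by
  induction j with
  | zero => simp [fallFact_zero]
  | succ j ih =>
    have hfactor : |(n : ℝ) - j| ≤ |(n : ℝ)| + (j + 1) := by
      refine (abs_sub _ _).trans ?_
      rw [Nat.abs_cast]
      linarith
    rw [fallFact_succ, pow_succ]
    push_cast
    rw [abs_mul]
    refine mul_le_mul (ih.trans ?_) hfactor (abs_nonneg _) (by positivity)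
    gcongr
    linarith

variable {d : ℕ}

/-- The multi-index falling factorial `∏ᵣ kᵣ (kᵣ - 1) ⋯ (kᵣ - Iᵣ + 1)`, the coefficient of
`D^I z^k` at `z = (1, …, 1)`. -/
noncomputable def multiFallFact (I : Fin d → ℕ) (k : Site d) : ℤ := ∏ r, fallFact (k r) (I r)

lemma multiFallFact_zero (k : Site d) : multiFallFact 0 k = 1 := by
  simp [multiFallFact, fallFact_zero]

lemma multiFallFact_add_single (J : Fin d → ℕ) (r : Fin d) (k : Site d) :
    multiFallFact (J + Pi.single r 1) k = multiFallFact J k * (k r - J r) := by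
  rw [multiFallFact, multiFallFact, ← Finset.mul_prod_erase _ _ (Finset.mem_univ r),
    ← Finset.mul_prod_erase _ _ (Finset.mem_univ r),
    Finset.prod_congr rfl (g := fun s => fallFact (k s) (J s))
      fun s hs => by simp [Finset.ne_of_mem_erase hs], Pi.add_apply, Pi.single_eq_same,
    fallFact_succ]
  ring

lemma multiFallFact_add (I : Fin d → ℕ) (k s : Site d) :
    multiFallFact I (k + s) = ∑ J ∈ Finset.Iic I,
      (∏ r, (I r).choose (J r)) * multiFallFact (I - J) s * multiFallFact J k := by
  have hIic : Finset.Iic I = Fintype.piFinset fun r => Finset.Iic (I r) := by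
    ext J
    simp [Pi.le_def]
  simp only [multiFallFact, Pi.add_apply, fallFact_add, Finset.prod_univ_sum, hIic,
    Finset.prod_mul_distrib, Pi.sub_apply, Nat.cast_prod]

lemma abs_multiFallFact_le (I : Fin d → ℕ) {k : Site d} {t : ℝ} (ht : ∀ r, |(k r : ℝ)| ≤ t) :
    |(multiFallFact I k : ℝ)| ≤ (t + ∑ r, I r) ^ ∑ r, I r := by
  rw [multiFallFact, Int.cast_prod, Finset.abs_prod, ← Finset.prod_pow_eq_pow_sum]
  refine Finset.prod_le_prod (fun _ _ => abs_nonneg _) fun r _ => (abs_fallFact_le _ _).trans ?_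
  gcongr
  · exact ht r
  · exact_mod_cast Finset.single_le_sum (f := I) (fun _ _ => Nat.zero_le _) (Finset.mem_univ r)

end FallFact

/-! ### Derivatives of the generating function -/

/-- The annulus `exp (-β) < |t| < exp β`; the generating function of a potential with decay rate
`α > β` converges when all variables lie in it. -/
def annulus (β : ℝ) : Set ℂ := {t | Real.exp (-β) < ‖t‖ ∧ ‖t‖ < Real.exp β}

lemma isOpen_annulus (β : ℝ) : IsOpen (annulus β) :=
  (isOpen_lt continuous_const continuous_norm).inter (isOpen_lt continuous_norm continuous_const)

lemma one_mem_annulus {β : ℝ} (hβ : 0 < β) : (1 : ℂ) ∈ annulus β := by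
  simp [annulus, hβ]

lemma ne_zero_of_mem_annulus {β : ℝ} {t : ℂ} (ht : t ∈ annulus β) : t ≠ 0 :=
  norm_pos_iff.1 ((Real.exp_pos _).trans ht.1)

lemma norm_zpow_le_of_mem_annulus {β : ℝ} {t : ℂ} (ht : t ∈ annulus β) (n : ℤ) :
    ‖t ^ n‖ ≤ Real.exp (β * |(n : ℝ)|) := by
  have hpos : 0 < ‖t‖ := norm_pos_iff.2 (ne_zero_of_mem_annulus ht)
  have hlog : |Real.log ‖t‖| ≤ β :=
    abs_le.2 ⟨(Real.le_log_iff_exp_le hpos).2 ht.1.le, (Real.log_le_iff_le_exp hpos).2 ht.2.le⟩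
  rw [norm_zpow, ← Real.rpow_intCast, Real.rpow_def_of_pos hpos]
  refine Real.exp_le_exp.2 ((le_abs_self _).trans ?_)
  rw [abs_mul]
  gcongr

section Deriv

variable {d : ℕ}

/-- The derivative `D^J z^k` of a Laurent monomial. -/
noncomputable def monomialDeriv (J : Fin d → ℕ) (k : Site d) (z : Fin d → ℂ) : ℂ :=
  multiFallFact J k * ∏ r, z r ^ (k r - J r)

lemma monomialDeriv_zero (k : Site d) (z : Fin d → ℂ) :
    monomialDeriv 0 k z = ∏ r, z r ^ k r := by
  simp [monomialDeriv, multiFallFact_zero]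

lemma monomialDeriv_one (J : Fin d → ℕ) (k : Site d) :
    monomialDeriv J k 1 = multiFallFact J k := by
  simp [monomialDeriv]

lemma hasDerivAt_prod_update_zpow (m : Fin d → ℤ) (z : Fin d → ℂ) (r : Fin d) {t : ℂ}
    (ht : t ≠ 0) :
    HasDerivAt (fun t => ∏ s, Function.update z r t s ^ m s)
      (m r * ∏ s, Function.update z r t s ^ (m s - (Pi.single r 1 : Fin d → ℤ) s)) t := by
  have hprod : ∀ (m : Fin d → ℤ) (t : ℂ), ∏ s, Function.update z r t s ^ m s =
      t ^ m r * ∏ s ∈ Finset.univ.erase r, z s ^ m s := fun m t => by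
    rw [← Finset.mul_prod_erase _ _ (Finset.mem_univ r), Function.update_self]
    congr 1
    exact Finset.prod_congr rfl fun s hs => by
      rw [Function.update_of_ne (Finset.ne_of_mem_erase hs)]
  have hrest : ∏ s ∈ Finset.univ.erase r, z s ^ (m s - (Pi.single r 1 : Fin d → ℤ) s) =
      ∏ s ∈ Finset.univ.erase r, z s ^ m s :=
    Finset.prod_congr rfl fun s hs => by
      rw [Pi.single_eq_of_ne (Finset.ne_of_mem_erase hs), sub_zero]
  rw [hprod fun s => m s - (Pi.single r 1 : Fin d → ℤ) s, hrest, Pi.single_eq_same, ← mul_assoc]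
  simp only [hprod m]
  exact (hasDerivAt_zpow _ _ (Or.inl ht)).mul_const _

lemma hasDerivAt_monomialDeriv_update (J : Fin d → ℕ) (k : Site d) (z : Fin d → ℂ) (r : Fin d)
    {t : ℂ} (ht : t ≠ 0) :
    HasDerivAt (fun t => monomialDeriv J k (Function.update z r t))
      (monomialDeriv (J + Pi.single r 1) k (Function.update z r t)) t := by
  refine ((hasDerivAt_prod_update_zpow (fun s => k s - J s) z r ht).const_mul
    (multiFallFact J k : ℂ)).congr_deriv ?_
  rw [monomialDeriv, multiFallFact_add_single, Int.cast_mul, mul_assoc]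
  congr! 4 with s
  rcases eq_or_ne s r with rfl | hs
  · simp [sub_sub]
  · simp [hs]

lemma exists_norm_monomialDeriv_le (J : Fin d → ℕ) {β γ : ℝ} (hβ : 0 ≤ β) (hγ : β < γ) :
    ∃ K, ∀ k z, (∀ r, z r ∈ annulus β) →
      ‖monomialDeriv J k z‖ ≤ K * Real.exp (γ * norm1 k) := by
  obtain ⟨K, -, hpow⟩ := exists_add_pow_le_mul_exp (b := (∑ r, J r : ℕ)) (c := γ - β)
    (by positivity) (sub_pos.2 hγ) (∑ r, J r)
  refine ⟨K * Real.exp (β * ∑ r, J r), fun k z hz => ?_⟩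
  have hcoeff : ‖(multiFallFact J k : ℂ)‖ ≤ K * Real.exp ((γ - β) * norm1 k) := by
    rw [Complex.norm_intCast]
    exact (abs_multiFallFact_le J (t := norm1 k) fun r => by
      exact_mod_cast abs_apply_le_norm1 k r).trans (hpow _ (by exact_mod_cast norm1_nonneg k))
  have hmono : ‖∏ r, z r ^ (k r - J r)‖ ≤ Real.exp (β * (norm1 k + ∑ r, J r)) := by
    rw [norm_prod, cast_norm1, Nat.cast_sum, ← Finset.sum_add_distrib, Finset.mul_sum, Real.exp_sum]
    refine Finset.prod_le_prod (fun _ _ => norm_nonneg _) fun r _ =>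
      (norm_zpow_le_of_mem_annulus (hz r) _).trans (Real.exp_le_exp.2 ?_)
    gcongr
    push_cast
    exact (abs_sub _ _).trans_eq (by rw [Nat.abs_cast])
  calc ‖monomialDeriv J k z‖
    _ ≤ K * Real.exp ((γ - β) * norm1 k) * Real.exp (β * (norm1 k + ∑ r, J r)) := by
        rw [monomialDeriv, norm_mul]
        exact mul_le_mul hcoeff hmono (norm_nonneg _) ((norm_nonneg _).trans hcoeff)
    _ = _ := by
        rw [mul_assoc, mul_assoc, ← Real.exp_add, ← Real.exp_add]
        ring_nf

variable {u : Site d → ℝ} {C α : ℝ}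

/-- The termwise derivative `∑ₖ u (-k) D^J z^k` of the generating function. -/
noncomputable def genFunDeriv (u : Site d → ℝ) (J : Fin d → ℕ) (z : Fin d → ℂ) : ℂ :=
  ∑' k, (u (-k) : ℂ) * monomialDeriv J k z

lemma ExpDecay.exists_norm_mul_monomialDeriv_le (hu : ExpDecay u C α) (J : Fin d → ℕ) :
    ∃ K, ∀ k z, (∀ r, z r ∈ annulus (α / 2)) →
      ‖(u (-k) : ℂ) * monomialDeriv J k z‖ ≤ K * Real.exp (-(α / 4) * norm1 k) := by
  obtain ⟨hC, hα, hdec⟩ := hu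
  obtain ⟨K, hK⟩ := exists_norm_monomialDeriv_le J (β := α / 2) (γ := 3 * α / 4)
    (by positivity) (by linarith)
  refine ⟨C * K, fun k z hz => ?_⟩
  rw [norm_mul, Complex.norm_real, Real.norm_eq_abs]
  have huk := hdec (-k)
  rw [norm1_neg] at huk
  refine (mul_le_mul huk (hK k z hz) (norm_nonneg _) (by positivity)).trans_eq ?_
  rw [mul_mul_mul_comm, ← Real.exp_add]
  ring_nf

lemma ExpDecay.deriv_genFunDeriv_update (hu : ExpDecay u C α) (J : Fin d → ℕ) (r : Fin d)
    {z : Fin d → ℂ} (hz : ∀ r, z r ∈ annulus (α / 2)) :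
    deriv (fun t => genFunDeriv u J (Function.update z r t)) (z r) =
      genFunDeriv u (J + Pi.single r 1) z := by
  obtain ⟨K, hK⟩ := hu.exists_norm_mul_monomialDeriv_le J
  have hderiv : ∀ k, ∀ t ∈ annulus (α / 2),
      HasDerivAt (fun t => (u (-k) : ℂ) * monomialDeriv J k (Function.update z r t))
        (u (-k) * monomialDeriv (J + Pi.single r 1) k (Function.update z r t)) t :=
    fun k t ht => (hasDerivAt_monomialDeriv_update J k z r (ne_zero_of_mem_annulus ht)).const_mul _
  have hsum := Complex.hasSum_deriv_of_summable_norm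
    ((summable_exp_neg_mul_norm1 (d := d) (β := α / 4) (by linarith [hu.2.1])).mul_left K)
    (fun k t ht => (hderiv k t ht).differentiableAt.differentiableWithinAt) (isOpen_annulus _)
    (fun k t ht => hK k _ fun s => ?_) (hz r)
  · simp only [genFunDeriv, ← hsum.tsum_eq, (hderiv _ _ (hz r)).deriv, Function.update_eq_self]
  · rcases eq_or_ne s r with rfl | hs
    · simpa using ht
    · simpa [hs] using hz s

lemma ExpDecay.partialDeriv_eq_genFunDeriv (hu : ExpDecay u C α) {H : (Fin d → ℂ) → ℂ}
    {J : Fin d → ℕ} (hH : ∀ z, (∀ r, z r ∈ annulus (α / 2)) → H z = genFunDeriv u J z)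
    (r : Fin d) (z : Fin d → ℂ) (hz : ∀ r, z r ∈ annulus (α / 2)) :
    partialDeriv r H z = genFunDeriv u (J + Pi.single r 1) z := by
  have hev : (fun t => H (Function.update z r t)) =ᶠ[nhds (z r)]
      fun t => genFunDeriv u J (Function.update z r t) := by
    filter_upwards [(isOpen_annulus _).mem_nhds (hz r)] with t ht
    refine hH _ fun s => ?_
    rcases eq_or_ne s r with rfl | hs
    · simpa using ht
    · simpa [hs] using hz s
  rw [partialDeriv, hev.deriv_eq, hu.deriv_genFunDeriv_update J r hz]

lemma ExpDecay.iterate_partialDeriv_eq_genFunDeriv (hu : ExpDecay u C α)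
    {H : (Fin d → ℂ) → ℂ} {J : Fin d → ℕ}
    (hH : ∀ z, (∀ r, z r ∈ annulus (α / 2)) → H z = genFunDeriv u J z) (r : Fin d) (n : ℕ)
    (z : Fin d → ℂ) (hz : ∀ r, z r ∈ annulus (α / 2)) :
    (partialDeriv r)^[n] H z = genFunDeriv u (J + Pi.single r n) z := by
  induction n generalizing z with
  | zero => simpa using hH z hz
  | succ n ih =>
    rw [Function.iterate_succ_apply', hu.partialDeriv_eq_genFunDeriv ih r z hz, add_assoc,
      ← Pi.single_add]

theorem ExpDecay.multiDeriv_genFun_eq_genFunDeriv (hu : ExpDecay u C α) (I : Fin d → ℕ)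
    {z : Fin d → ℂ} (hz : ∀ r, z r ∈ annulus (α / 2)) :
    multiDeriv I (genFun u) z = genFunDeriv u I z := by
  have hfoldr : ∀ (L : List (Fin d)) (z : Fin d → ℂ), (∀ r, z r ∈ annulus (α / 2)) →
      L.foldr (fun r H => (partialDeriv r)^[I r] H) (genFun u) z =
        genFunDeriv u (L.map fun r => (Pi.single r (I r) : Fin d → ℕ)).sum z := by
    intro L
    induction L with
    | nil => simp [genFun, genFunDeriv, monomialDeriv_zero]
    | cons r L ih =>
      intro z hz
      rw [List.foldr_cons, hu.iterate_partialDeriv_eq_genFunDeriv ih r (I r) z hz, List.map_cons,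
        List.sum_cons, add_comm]
  rw [multiDeriv, hfoldr _ z hz, ← List.ofFn_eq_map, List.sum_ofFn, Finset.univ_sum_single]

/-! ### Moments of the single-site potential -/

/-- The factorial moment `∑ₖ u (-k) ∏ᵣ kᵣ (kᵣ - 1) ⋯ (kᵣ - Iᵣ + 1)`, that is `(D^I F)(1, …, 1)` as a
real number. -/
noncomputable def moment (u : Site d → ℝ) (I : Fin d → ℕ) : ℝ :=
  ∑' k : Site d, u (-k) * multiFallFact I k

lemma ExpDecay.hasSum_moment (hu : ExpDecay u C α) (I : Fin d → ℕ) :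
    HasSum (fun k : Site d => u (-k) * multiFallFact I k) (moment u I) := by
  obtain ⟨K, hK⟩ := hu.exists_norm_mul_monomialDeriv_le I
  have hα := hu.2.1
  refine (Summable.of_norm_bounded ((summable_exp_neg_mul_norm1 (d := d) (β := α / 4)
    (by positivity)).mul_left K) fun k => ?_).hasSum
  simpa [monomialDeriv_one] using hK k 1 fun _ => one_mem_annulus (by positivity)

lemma ExpDecay.multiDeriv_genFun_one (hu : ExpDecay u C α) (I : Fin d → ℕ) :
    multiDeriv I (genFun u) 1 = moment u I := by
  rw [hu.multiDeriv_genFun_eq_genFunDeriv I (z := 1) fun _ => one_mem_annulus (half_pos hu.2.1),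
    genFunDeriv, moment, Complex.ofReal_tsum]
  simp [monomialDeriv_one]

variable {I₀ : Fin d → ℕ}

lemma IsLeadingIndex.moment_ne_zero (hI₀ : IsLeadingIndex u I₀) (hu : ExpDecay u C α) :
    moment u I₀ ≠ 0 := by
  simpa [hu.multiDeriv_genFun_one] using hI₀.1

lemma IsLeadingIndex.moment_eq_zero (hI₀ : IsLeadingIndex u I₀) (hu : ExpDecay u C α)
    {I : Fin d → ℕ} (hI : I < I₀) : moment u I = 0 := by
  simpa [hu.multiDeriv_genFun_one] using hI₀.2 I hI

/-- Expanding `multiFallFact I₀ (k + s)` in products, only the top moment survives. -/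
lemma IsLeadingIndex.hasSum_multiFallFact_add (hI₀ : IsLeadingIndex u I₀) (hu : ExpDecay u C α)
    (s : Site d) :
    HasSum (fun k => u (-k) * multiFallFact I₀ (k + s)) (moment u I₀) := by
  have hexpand : ∀ k, u (-k) * (multiFallFact I₀ (k + s) : ℝ) = ∑ J ∈ Finset.Iic I₀,
      ((∏ r, (I₀ r).choose (J r)) * multiFallFact (I₀ - J) s : ℝ) *
        (u (-k) * multiFallFact J k) := fun k => by
    rw [multiFallFact_add]
    push_cast
    rw [Finset.mul_sum]
    exact Finset.sum_congr rfl fun J _ => by ring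
  have hsum := hasSum_sum (s := Finset.Iic I₀) fun J _ => (hu.hasSum_moment J).mul_left
    ((∏ r, (I₀ r).choose (J r)) * multiFallFact (I₀ - J) s : ℝ)
  rw [Finset.sum_eq_single_of_mem I₀ (by simp) fun J hJ hne => by
    rw [hI₀.moment_eq_zero hu (lt_of_le_of_ne (Finset.mem_Iic.1 hJ) hne), mul_zero]] at hsum
  simpa [hexpand, multiFallFact_zero] using hsum

theorem IsLeadingIndex.hasSum_multiFallFact_sub (hI₀ : IsLeadingIndex u I₀)
    (hu : ExpDecay u C α) (x y : Site d) :
    HasSum (fun k => multiFallFact I₀ (k - y) * u (x - k)) (moment u I₀) := by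
  convert (Equiv.subRight x).hasSum_iff.2 (hI₀.hasSum_multiFallFact_add hu (x - y)) using 1
  funext k
  simp [mul_comm]

lemma ExpDecay.exists_abs_multiFallFact_mul_le (hu : ExpDecay u C α) (I : Fin d → ℕ) :
    ∃ K, 0 ≤ K ∧ ∀ (l : ℝ) (x y k : Site d), x ∈ cube l y → k ∉ cube (4 * l) y →
      |multiFallFact I (k - y) * u (x - k)| ≤
        K * Real.exp (-(3 * α / 2 * l)) * Real.exp (-(α / 4) * norm1 (x - k)) := by
  obtain ⟨hC, hα, hdec⟩ := hu
  obtain ⟨K, hK, hpow⟩ := exists_add_pow_le_mul_exp (b := (∑ r, I r : ℕ)) (c := α / 8)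
    (by positivity) (by positivity) (∑ r, I r)
  refine ⟨K * C, by positivity, fun l x y k hx hk => ?_⟩
  have hdist : 3 * l < norm1 (x - k) := lt_norm1_sub_of_notMem_cube hx hk
  have hnonneg : (0 : ℝ) ≤ norm1 (x - k) := by exact_mod_cast norm1_nonneg (x - k)
  have hcoord : ∀ r, |((k - y) r : ℝ)| ≤ 2 * norm1 (x - k) := fun r => by
    have hxk : |(x r : ℝ) - k r| ≤ norm1 (x - k) := by
      exact_mod_cast abs_apply_le_norm1 (x - k) r
    rw [abs_sub_comm] at hxk
    push_cast [Pi.sub_apply]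
    linarith [abs_sub_le (k r : ℝ) (x r) (y r), hx r]
  have hcoeff : |(multiFallFact I (k - y) : ℝ)| ≤ K * Real.exp (α / 4 * norm1 (x - k)) :=
    (abs_multiFallFact_le I hcoord).trans ((hpow _ (by positivity)).trans_eq (by ring_nf))
  calc |multiFallFact I (k - y) * u (x - k)|
    _ ≤ K * Real.exp (α / 4 * norm1 (x - k)) * (C * Real.exp (-α * norm1 (x - k))) := by
        rw [abs_mul]
        exact mul_le_mul hcoeff (hdec (x - k)) (abs_nonneg _) (by positivity)
    _ = K * C * Real.exp (α / 4 * norm1 (x - k) + -α * norm1 (x - k)) := by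
        rw [Real.exp_add]
        ring
    _ ≤ K * C * Real.exp (-(3 * α / 2 * l) + -(α / 4) * norm1 (x - k)) := by
        gcongr ?_ * Real.exp ?_
        linarith [mul_lt_mul_of_pos_left hdist hα]
    _ = _ := by rw [Real.exp_add, mul_assoc (K * C)]

lemma IsLeadingIndex.exists_abs_moment_sub_sum_le (hI₀ : IsLeadingIndex u I₀)
    (hu : ExpDecay u C α) :
    ∃ B, ∀ (l : ℝ) (x y : Site d), x ∈ cube l y →
      |moment u I₀ - ∑ k ∈ cubeFinset (4 * l) y, multiFallFact I₀ (k - y) * u (x - k)| ≤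
        B * Real.exp (-(3 * α / 2 * l)) := by
  obtain ⟨K, hK, hterm⟩ := hu.exists_abs_multiFallFact_mul_le I₀
  refine ⟨K * expSum d (α / 4), fun l x y hx => ?_⟩
  rw [mul_right_comm]
  exact abs_sub_sum_le_of_exp_bound (by linarith [hu.2.1]) (hI₀.hasSum_multiFallFact_sub hu x y)
    (by positivity) x fun k hk => hterm l x y k hx (mem_cubeFinset.not.1 hk)

theorem IsLeadingIndex.exists_half_le_sum_div_moment (hI₀ : IsLeadingIndex u I₀)
    (hu : ExpDecay u C α) :
    ∃ l₀ : ℝ, ∀ (l : ℝ) (x y : Site d), l₀ ≤ l → x ∈ cube l y →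
      1 / 2 ≤ (∑ k ∈ cubeFinset (4 * l) y, multiFallFact I₀ (k - y) * u (x - k)) / moment u I₀ := by
  have hne := hI₀.moment_ne_zero hu
  obtain ⟨B, hB⟩ := hI₀.exists_abs_moment_sub_sum_le hu
  have hlim : Filter.Tendsto (fun l : ℝ => B * Real.exp (-(3 * α / 2 * l))) Filter.atTop
      (nhds 0) := by
    simpa using (Real.tendsto_exp_neg_atTop_nhds_zero.comp (Filter.tendsto_id.const_mul_atTop
      (by linarith [hu.2.1] : 0 < 3 * α / 2))).const_mul B
  obtain ⟨l₀, hl₀⟩ := Filter.eventually_atTop.1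
    (hlim.eventually_lt_const (half_pos (abs_pos.2 hne)))
  refine ⟨l₀, fun l x y hl hx => ?_⟩
  set truncated := ∑ k ∈ cubeFinset (4 * l) y, multiFallFact I₀ (k - y) * u (x - k)
  have hratio : |1 - truncated / moment u I₀| ≤ 1 / 2 := by
    rw [one_sub_div hne, abs_div, div_le_iff₀ (abs_pos.2 hne)]
    linarith [hB l x y hx, hl₀ l hl]
  linarith [(abs_le.1 hratio).2]

end Deriv

/-! ### Truncation of the couplings -/

section Truncation

variable {d : ℕ} {u : Site d → ℝ} {C α : ℝ}

/-- The part of the potential `v_ω` generated by the couplings in `Γ`. -/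
noncomputable def localPotential (u : Site d → ℝ) (Γ : Finset (Site d)) (ω : Site d → ℝ)
    (x : Site d) : ℝ := ∑ k ∈ Γ, ω k * u (x - k)

/-- The ordered eigenvalues on the cube of radius `l` when all couplings outside the cube of radius
`4 * l` are set to zero; unlike the spectrum of `boxOp` they depend on finitely many couplings. -/
noncomputable def cubeEigenvalues (u : Site d → ℝ) (l : ℝ) (y : Site d) (ω : Site d → ℝ) :
    Fin (Fintype.card (cube l y)) → ℝ :=
  boxEigenvalues (cube l y) fun x => localPotential u (cubeFinset (4 * l) y) ω x

/-- The event that two truncated eigenvalues on the cubes of radii `l₁`, `l₂` around `x`, `y` have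
distance less than `ε`. -/
def closeLevels (u : Site d → ℝ) (x y : Site d) (l₁ l₂ ε : ℝ) : Set (Site d → ℝ) :=
  {ω | ∃ i j, |cubeEigenvalues u l₁ x ω i - cubeEigenvalues u l₂ y ω j| < ε}

lemma measurable_cubeEigenvalues (u : Site d → ℝ) (l : ℝ) (y : Site d)
    (i : Fin (Fintype.card (cube l y))) : Measurable fun ω => cubeEigenvalues u l y ω i := by
  refine (continuous_boxEigenvalues (cube l y) i).measurable.comp (measurable_pi_iff.2 fun x => ?_)
  exact Finset.measurable_sum _ fun k _ => (measurable_pi_apply k).mul_const _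

lemma ExpDecay.abs_potential_sub_localPotential_le (hu : ExpDecay u C α) {ω : Site d → ℝ} {R : ℝ}
    (hR : ∀ k, |ω k| ≤ R) {l : ℝ} {x y : Site d} (hx : x ∈ cube l y) :
    |potential u ω x - localPotential u (cubeFinset (4 * l) y) ω x| ≤
      R * C * expSum d (α / 2) * Real.exp (-(3 * l * α / 2)) := by
  obtain ⟨hC, hα, hdec⟩ := hu
  have hR0 : 0 ≤ R := (abs_nonneg _).trans (hR 0)
  have hterm : ∀ k, |ω k * u (x - k)| ≤ R * C * Real.exp (-α * norm1 (x - k)) := fun k => by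
    rw [abs_mul, mul_assoc]
    exact mul_le_mul (hR k) (hdec _) (abs_nonneg _) hR0
  have hsummable : Summable fun k => ω k * u (x - k) :=
    Summable.of_norm_bounded ((hasSum_exp_neg_mul_norm1_sub hα x).summable.mul_left (R * C)) hterm
  rw [mul_right_comm]
  refine abs_sub_sum_le_of_exp_bound (by positivity) hsummable.hasSum (by positivity) x
    fun k hk => (hterm k).trans ?_
  have hdist := lt_norm1_sub_of_notMem_cube hx (mem_cubeFinset.not.1 hk)
  rw [mul_assoc (R * C), ← Real.exp_add]
  gcongr ?_ * Real.exp ?_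
  linarith [mul_lt_mul_of_pos_left hdist hα]

lemma ExpDecay.exists_abs_sub_cubeEigenvalues_le (hu : ExpDecay u C α) {μ : Measure ℝ} {R : ℝ}
    (hR : ∀ t ∈ μ.support, |t| ≤ R) {l : ℝ} {y : Site d} {ω : Site d → ℝ} (hω : ω ∈ conf d μ)
    {ω' : ((cube (4 * l) y)ᶜ : Set (Site d)) → ℝ} (hω' : ω' ∈ confOn μ (cube (4 * l) y)ᶜ) {a : ℂ}
    (ha : a ∈ spectrum ℂ (boxOp u (cube l y)
      (glue (cube (4 * l) y) ((cube (4 * l) y).domRestrict ω) ω'))) :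
    ∃ i, ∃ t : ℝ, a = t ∧ |t - cubeEigenvalues u l y ω i| ≤
      R * C * expSum d (α / 2) * Real.exp (-(3 * l * α / 2)) := by
  obtain ⟨i, rfl⟩ := spectrum_boxOp_subset_range _ _ _ ha
  refine ⟨i, _, rfl, abs_boxEigenvalues_sub_le _ (fun x => ?_) i⟩
  have hglue : ∀ k, |glue (cube (4 * l) y) ((cube (4 * l) y).domRestrict ω) ω' k| ≤ R := fun k => by
    rw [glue]
    split_ifs with hk
    · exact hR _ (hω k)
    · exact hR _ (hω' _)
  have hlocal : localPotential u (cubeFinset (4 * l) y)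
      (glue (cube (4 * l) y) ((cube (4 * l) y).domRestrict ω) ω') x =
      localPotential u (cubeFinset (4 * l) y) ω x :=
    Finset.sum_congr rfl fun k hk => by
      rw [glue, dif_pos (mem_cubeFinset.1 hk), Set.domRestrict_apply]
  exact hlocal ▸ hu.abs_potential_sub_localPotential_le hglue x.2

theorem ExpDecay.exists_resonanceEvent_subset_closeLevels (hu : ExpDecay u C α) {μ : Measure ℝ}
    (hμ : Bornology.IsBounded μ.support) :
    ∃ C₂, 0 ≤ C₂ ∧ ∀ (x y : Site d) (l₁ l₂ ε : ℝ), resonanceEvent u μ x y l₁ l₂ ε ⊆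
      closeLevels u x y l₁ l₂ (ε + C₂ * Real.exp (-(3 * min l₁ l₂ * α / 2))) := by
  obtain ⟨R, hR0, hR⟩ := hμ.exists_pos_norm_le
  obtain ⟨hC, hα, -⟩ := id hu
  have hK : 0 ≤ R * C * expSum d (α / 2) :=
    mul_nonneg (mul_nonneg hR0.le hC.le) (expSum_nonneg d _)
  refine ⟨2 * (R * C * expSum d (α / 2)), by positivity, fun x y l₁ l₂ ε ω ⟨hconf, hlt⟩ => ?_⟩
  simp only [unifDist, setDist, iInf_lt_iff] at hlt
  obtain ⟨ω₁, hω₁, ω₂, hω₂, a, ha, b, hb, hab⟩ := hlt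
  obtain ⟨i, s, rfl, hs⟩ := hu.exists_abs_sub_cubeEigenvalues_le hR hconf hω₁ ha
  obtain ⟨j, t, rfl, ht⟩ := hu.exists_abs_sub_cubeEigenvalues_le hR hconf hω₂ hb
  rw [edist_lt_ofReal, Complex.isometry_ofReal.dist_eq, Real.dist_eq] at hab
  have hexp : ∀ l, min l₁ l₂ ≤ l → R * C * expSum d (α / 2) * Real.exp (-(3 * l * α / 2)) ≤
      R * C * expSum d (α / 2) * Real.exp (-(3 * min l₁ l₂ * α / 2)) := fun l hl => by
    gcongr
  refine ⟨i, j, ?_⟩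
  rw [abs_sub_comm] at hs
  linarith [abs_sub_le (cubeEigenvalues u l₁ x ω i) s (cubeEigenvalues u l₂ y ω j),
    abs_sub_le s t (cubeEigenvalues u l₂ y ω j), hexp l₁ (min_le_left _ _),
    hexp l₂ (min_le_right _ _)]

end Truncation

/-! ### Probability of close levels -/

section CloseLevels

variable {ι : Type*} [DecidableEq ι] {μ : ι → Measure ℝ} [∀ i, IsProbabilityMeasure (μ i)]
  {V : ℝ≥0} {s : Finset ι} {a : ι → ℝ} {ε : ℝ}

/-- With `S = {lam < E + ε}`, the translate of `S` is a subset of `S` and misses the event. -/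
lemma infinitePi_abs_sub_lt_le (hμ : ∀ i, TranslationLipschitz (μ i) V) {E lam : (ι → ℝ) → ℝ}
    (hE : Measurable E) (hlam : Measurable lam) (hε : 0 ≤ ε)
    (hEa : ∀ ω, E (ω + ∑ k ∈ s, Pi.single k (a k)) = E ω)
    (hlama : ∀ ω, lam ω + 2 * ε ≤ lam (ω + ∑ k ∈ s, Pi.single k (a k))) :
    Measure.infinitePi μ {ω | |E ω - lam ω| < ε} ≤ V * ∑ k ∈ s, ‖a k‖ₑ := by
  set S : Set (ι → ℝ) := {ω | lam ω < E ω + ε}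
  set T : Set (ι → ℝ) := (· + ∑ k ∈ s, Pi.single k (a k)) ⁻¹' S
  have hS : MeasurableSet S := measurableSet_lt hlam (hE.add_const ε)
  have hT : MeasurableSet T := measurable_id.add_const _ hS
  have hmemT : ∀ ω, ω ∈ T → lam ω + ε < E ω := fun ω hω => by
    have hlt : lam (ω + ∑ k ∈ s, Pi.single k (a k)) < E (ω + ∑ k ∈ s, Pi.single k (a k)) + ε := hω
    linarith [hlama ω, hEa ω]
  have hTS : T ⊆ S := fun ω hω => show lam ω < E ω + ε by linarith [hmemT ω hω]
  calc Measure.infinitePi μ {ω | |E ω - lam ω| < ε}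
    _ ≤ Measure.infinitePi μ (S \ T) := measure_mono fun ω hω => by
        have hclose := abs_lt.1 (show |E ω - lam ω| < ε from hω)
        exact ⟨show lam ω < E ω + ε by linarith, fun hωT => by linarith [hmemT ω hωT]⟩
    _ = Measure.infinitePi μ S - Measure.infinitePi μ T :=
        measure_sdiff hTS hT.nullMeasurableSet (measure_ne_top _ _)
    _ ≤ V * ∑ k ∈ s, ‖a k‖ₑ :=
        tsub_le_iff_left.2 (infinitePi_le_preimage_add_sum_single hμ hS s a)

lemma infinitePi_exists_abs_sub_lt_le (hμ : ∀ i, TranslationLipschitz (μ i) V) {m n : Type*}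
    [Fintype m] [Fintype n] {E : (ι → ℝ) → m → ℝ} {lam : (ι → ℝ) → n → ℝ}
    (hE : ∀ i, Measurable fun ω => E ω i) (hlam : ∀ j, Measurable fun ω => lam ω j) (hε : 0 ≤ ε)
    (hEa : ∀ ω, E (ω + ∑ k ∈ s, Pi.single k (a k)) = E ω)
    (hlama : ∀ ω j, lam ω j + 2 * ε ≤ lam (ω + ∑ k ∈ s, Pi.single k (a k)) j) :
    Measure.infinitePi μ {ω | ∃ i j, |E ω i - lam ω j| < ε} ≤
      Fintype.card m * (Fintype.card n * (V * ∑ k ∈ s, ‖a k‖ₑ)) := by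
  simp only [Set.ofPred_exists]
  calc Measure.infinitePi μ (⋃ i, ⋃ j, {ω | |E ω i - lam ω j| < ε})
    _ ≤ ∑ i, ∑ j, Measure.infinitePi μ {ω | |E ω i - lam ω j| < ε} :=
        (measure_iUnion_fintype_le _ _).trans
          (Finset.sum_le_sum fun i _ => measure_iUnion_fintype_le _ _)
    _ ≤ ∑ _i : m, ∑ _j : n, V * ∑ k ∈ s, ‖a k‖ₑ :=
        Finset.sum_le_sum fun i _ => Finset.sum_le_sum fun j _ =>
          infinitePi_abs_sub_lt_le hμ (hE i) (hlam j) hε (fun ω => by rw [hEa])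
            fun ω => hlama ω j
    _ = _ := by simp only [Finset.sum_const, Finset.card_univ, nsmul_eq_mul]

end CloseLevels

section Resonance

variable {d : ℕ} {u : Site d → ℝ} {C α : ℝ} {I₀ : Fin d → ℕ}

lemma localPotential_add_sum_single_of_disjoint {Γ Γ' : Finset (Site d)} (h : Disjoint Γ Γ')
    (ω a : Site d → ℝ) :
    localPotential u Γ (ω + ∑ k ∈ Γ', Pi.single k (a k)) = localPotential u Γ ω := by
  funext z
  refine Finset.sum_congr rfl fun k hk => ?_
  rw [Pi.add_apply, Finset.sum_apply, Finset.sum_pi_single, if_neg (Finset.disjoint_left.1 h hk),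
    add_zero]

lemma localPotential_add_sum_single (Γ : Finset (Site d)) (ω a : Site d → ℝ) (z : Site d) :
    localPotential u Γ (ω + ∑ k ∈ Γ, Pi.single k (a k)) z =
      localPotential u Γ ω z + ∑ k ∈ Γ, a k * u (z - k) := by
  simp only [localPotential]
  rw [← Finset.sum_add_distrib]
  refine Finset.sum_congr rfl fun k hk => ?_
  rw [Pi.add_apply, Finset.sum_apply, Finset.sum_pi_single, if_pos hk, add_mul]

lemma prodMeasure_closeLevels_le {μ : Measure ℝ} [IsProbabilityMeasure μ] {V : ℝ≥0}
    (hμ : TranslationLipschitz μ V) {x y : Site d} {l₁ l₂ : ℝ}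
    (hdisj : Disjoint (cube (4 * l₁) x) (cube (4 * l₂) y)) {ε : ℝ} (hε : 0 ≤ ε) {a : Site d → ℝ}
    (ha : ∀ z ∈ cube l₂ y, 2 * ε ≤ ∑ k ∈ cubeFinset (4 * l₂) y, a k * u (z - k)) :
    (prodMeasure d μ).real (closeLevels u x y l₁ l₂ ε) ≤
      Fintype.card (cube l₁ x) * (Fintype.card (cube l₂ y) *
        (V * ∑ k ∈ cubeFinset (4 * l₂) y, |a k|)) := by
  have hdisj' : Disjoint (cubeFinset (4 * l₁) x) (cubeFinset (4 * l₂) y) :=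
    Finset.disjoint_left.2 fun k hk hk' =>
      Set.disjoint_left.1 hdisj (mem_cubeFinset.1 hk) (mem_cubeFinset.1 hk')
  have hbound := infinitePi_exists_abs_sub_lt_le (fun _ => hμ) (s := cubeFinset (4 * l₂) y)
    (a := a) (measurable_cubeEigenvalues u l₁ x) (measurable_cubeEigenvalues u l₂ y) hε
    (fun ω => by simp only [cubeEigenvalues, localPotential_add_sum_single_of_disjoint hdisj'])
    (fun ω j => boxEigenvalues_add_le _
      (fun z => by rw [localPotential_add_sum_single]; gcongr; exact ha z z.2) j)
  have hfinite : ∑ k ∈ cubeFinset (4 * l₂) y, ‖a k‖ₑ ≠ ∞ :=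
    ENNReal.sum_ne_top.2 fun _ _ => enorm_ne_top
  refine (ENNReal.toReal_mono (by finiteness) hbound).trans_eq ?_
  simp [ENNReal.toReal_sum]

lemma sum_abs_multiFallFact_le (I : Fin d → ℕ) {l : ℝ} (hl : 0 ≤ l) (y : Site d) :
    ∑ k ∈ cubeFinset (4 * l) y, |(multiFallFact I (k - y) : ℝ)| ≤
      (4 * (2 * l + 1)) ^ d * ((2 + ∑ r, I r : ℝ) * (2 * l + 1)) ^ ∑ r, I r := by
  have hterm : ∀ k ∈ cubeFinset (4 * l) y, |(multiFallFact I (k - y) : ℝ)| ≤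
      ((2 + ∑ r, I r : ℝ) * (2 * l + 1)) ^ ∑ r, I r := fun k hk => by
    refine (abs_multiFallFact_le I (t := 4 * l) fun r => ?_).trans ?_
    · simpa using mem_cubeFinset.1 hk r
    · have hN : (0 : ℝ) ≤ ∑ r, (I r : ℝ) := by positivity
      push_cast
      gcongr
      nlinarith
  refine (Finset.sum_le_card_nsmul _ _ _ hterm).trans ?_
  rw [nsmul_eq_mul]
  gcongr
  refine (card_cubeFinset_le (by positivity) y).trans ?_
  gcongr
  linarith

theorem IsLeadingIndex.exists_prodMeasure_closeLevels_le (hI₀ : IsLeadingIndex u I₀)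
    (hu : ExpDecay u C α) :
    ∃ l₀ : ℝ, ∀ (μ : Measure ℝ) [IsProbabilityMeasure μ] (V : ℝ≥0), TranslationLipschitz μ V →
      ∃ C₁, 0 < C₁ ∧ ∀ (x y : Site d) (l₁ l₂ : ℝ), 0 ≤ l₁ → 0 ≤ l₂ →
        Disjoint (cube (4 * l₁) x) (cube (4 * l₂) y) → l₀ ≤ l₂ → ∀ ε, 0 ≤ ε →
          (prodMeasure d μ).real (closeLevels u x y l₁ l₂ ε) ≤
            C₁ * (2 * max l₁ l₂ + 1) ^ (3 * d + ∑ r, I₀ r) * ε := by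
  have hc := abs_pos.2 (hI₀.moment_ne_zero hu)
  obtain ⟨l₀, hl₀⟩ := hI₀.exists_half_le_sum_div_moment hu
  refine ⟨l₀, fun μ _ V hμ => ⟨4 ^ d * (2 + ∑ r, I₀ r : ℝ) ^ (∑ r, I₀ r) * (4 / |moment u I₀|) *
    (V + 1), by positivity, fun x y l₁ l₂ hl₁ hl₂ hdisj hl ε hε => ?_⟩⟩
  set Q := 2 * max l₁ l₂ + 1
  have hQ₁ : 2 * l₁ + 1 ≤ Q := by linarith [le_max_left l₁ l₂]
  have hQ₂ : 2 * l₂ + 1 ≤ Q := by linarith [le_max_right l₁ l₂]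
  set a : Site d → ℝ := fun k => 4 * ε / moment u I₀ * multiFallFact I₀ (k - y)
  have hraise : ∀ z ∈ cube l₂ y, 2 * ε ≤ ∑ k ∈ cubeFinset (4 * l₂) y, a k * u (z - k) :=
    fun z hz => by
      have hhalf := mul_le_mul_of_nonneg_left (hl₀ l₂ z y hl hz) (by positivity : 0 ≤ 4 * ε)
      simp only [a, mul_assoc, ← Finset.mul_sum]
      rw [div_mul_eq_mul_div, mul_div_assoc]
      linarith
  have hsum : ∑ k ∈ cubeFinset (4 * l₂) y, |a k| ≤
      4 * ε / |moment u I₀| * ((4 * Q) ^ d * ((2 + ∑ r, I₀ r : ℝ) * Q) ^ ∑ r, I₀ r) := by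
    simp only [a, abs_mul, abs_div, abs_of_nonneg hε, Nat.abs_ofNat, ← Finset.mul_sum]
    gcongr
    refine (sum_abs_multiFallFact_le I₀ hl₂ y).trans ?_
    gcongr
  calc (prodMeasure d μ).real (closeLevels u x y l₁ l₂ ε)
    _ ≤ Fintype.card (cube l₁ x) * (Fintype.card (cube l₂ y) *
          (V * ∑ k ∈ cubeFinset (4 * l₂) y, |a k|)) :=
        prodMeasure_closeLevels_le hμ hdisj hε hraise
    _ ≤ Q ^ d * (Q ^ d * ((V + 1) * (4 * ε / |moment u I₀| *
          ((4 * Q) ^ d * ((2 + ∑ r, I₀ r : ℝ) * Q) ^ ∑ r, I₀ r)))) := by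
        gcongr
        · exact (card_cube_le hl₁ x).trans (by gcongr)
        · exact (card_cube_le hl₂ y).trans (by gcongr)
        · linarith
    _ = _ := by
        rw [mul_pow, mul_pow, pow_add, pow_mul']
        ring

end Resonance

end AlloyType

theorem proposition5p1 {d : ℕ} (u : AlloyType.Site d → ℝ) (C α : ℝ)
    (hu : AlloyType.ExpDecay u C α)
    (I₀ : Fin d → ℕ) (hI₀ : AlloyType.IsLeadingIndex u I₀) :
    ∃ l₀ : ℝ, ∀ (μ : Measure ℝ) [IsProbabilityMeasure μ] (ρ : ℝ → ℝ),
      Bornology.IsBounded μ.support → AlloyType.IsDensity μ ρ → AlloyType.IsBV ρ →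
      ∃ C₁ C₂ : ℝ, 0 < C₁ ∧
        ∀ (x y : AlloyType.Site d) (l₁ l₂ : ℝ), 0 < l₁ → 0 < l₂ →
          Disjoint (AlloyType.cube (4 * l₁) x) (AlloyType.cube (4 * l₂) y) → l₀ ≤ l₂ →
          ∀ ε : ℝ, 0 < ε →
            (AlloyType.prodMeasure d μ).real (AlloyType.resonanceEvent u μ x y l₁ l₂ ε)
              ≤ C₁ * (2 * max l₁ l₂ + 1) ^ (3 * d + ∑ r, I₀ r) *
                  (ε + C₂ * Real.exp (-(3 * min l₁ l₂ * α / 2))) := by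
  obtain ⟨l₀, hl₀⟩ := hI₀.exists_prodMeasure_closeLevels_le hu
  refine ⟨l₀, fun μ _ ρ hsupp hμ hρ => ?_⟩
  obtain ⟨V, hV⟩ := hρ.exists_variationBound
  obtain ⟨C₁, hC₁, hclose⟩ := hl₀ μ V (hμ.translationLipschitz hρ.1 hV)
  obtain ⟨C₂, hC₂, hsub⟩ := hu.exists_resonanceEvent_subset_closeLevels hsupp
  refine ⟨C₁, C₂, hC₁, fun x y l₁ l₂ hl₁ hl₂ hdisj hl ε hε => ?_⟩
  have : IsProbabilityMeasure (AlloyType.prodMeasure d μ) := by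
    rw [AlloyType.prodMeasure]
    infer_instance
  exact (measureReal_mono (hsub x y l₁ l₂ ε)).trans
    (hclose x y l₁ l₂ hl₁.le hl₂.le hdisj hl _ (by positivity))
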